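/- All graphs are finite, connected, undirected and simple, and $\partial A$ denotes the set of vertices at edge-path distance exactly $1$ from the vertex set $A$. The Cheeger constant of a graph $(V,E)$ is $$\mathrm{ch}(V,E)=\min\Big\{\tfrac{|\partial A|}{|A|} : A\subseteq V,\ 0<|A|\le \tfrac{|V|}{2}\Big\},$$ and, if $m$ is a nonzero finite measure on (all subsets of) $V$, $$\mathrm{ch}(V,E,m)=\min\Big\{\tfrac{m(\partial A)}{m(A)} : A\subseteq V,\ 0<m(A)\le \tfrac12 m(V)\Big\},$$ where the minimum over the empty set is $+\infty$. A sequence of graphs has uniformly bounded valency if one constant bounds the number of neighbours of every vertex of every graph in it. A sequence $\{(V_n,E_n)\}_{n\in\mathbb N}$ is a sequence of expanders if it has uniformly bounded valency, $|V_n|\to\infty$ and $\inf_n\mathrm{ch}(V_n,E_n)>0$; a sequence $\{(V_n,E_n,m_n)\}_{n\in\mathbb N}$ is a sequence of measured expanders if $\inf_n \mathrm{ch}(V_n,E_n,m_n)>0$, and it is ghostly if $\lim_{n\to\infty}\sup_{v\in V_n} m_n(\{v\})/m_n(V_n)=0$. **Proposition.** There exists a sequence of ghostly measured expanders $\{(V_n,E_n,m_n)\}_{n\in\mathbb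 N}$ with uniformly bounded valency such that the underlying graphs $\{(V_n,E_n)\}_{n\in\mathbb N}$ are not expanders. More precisely, for a graph $\mathcal H=(W,F)$ and $n\in\mathbb N$ (with $0\in\mathbb N$), let $\mathcal K_n(\mathcal H)$ be the Cartesian product of $\mathcal H$ with the path on $\{0,1,\dots,n\}$, endowed with the measure whose restriction to the slice $W\times\{i\}$ is $2^{-i}$ times the normalised counting measure of $W$. Then for every sequence $\{\mathcal H_n\}_{n\in\mathbb N}$ of expanders, $\{\mathcal K_n(\mathcal H_n)\}_{n\in\mathbb N}$ is a sequence of ghostly measured expanders with uniformly bounded valency whose underlying graphs are not expanders; and sequences of expanders exist, so this gives a sequence as required. -/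

import Mathlib

open MeasureTheory Filter Topology
open scoped ENNReal

noncomputable section

namespace MeasuredExpander

/-! ### Boundaries and Cheeger constants -/

/-- The vertex boundary of `A`: all vertices at edge-path distance exactly `1` from `A`. -/
def vertexBoundary {V : Type} (G : SimpleGraph V) (A : Set V) : Set V :=
  {v | ⨅ a ∈ A, G.edist v a = 1}

/-- A vertex lies in the vertex boundary of `A` iff it is outside `A` and adjacent to a point
of `A`. -/
theorem mem_vertexBoundary_iff {V : Type} (G : SimpleGraph V) (A : Set V) (v : V) :
    v ∈ vertexBoundary G A ↔ v ∉ A ∧ ∃ a ∈ A, G.Adj v a := by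
  unfold vertexBoundary
  constructor
  · intro h
    have h : ⨅ a ∈ A, G.edist v a = 1 := h
    have hv : v ∉ A := by
      intro hv
      have h0 : ⨅ a ∈ A, G.edist v a ≤ G.edist v v := iInf₂_le v hv
      rw [h, SimpleGraph.edist_self] at h0
      simp at h0
    refine ⟨hv, ?_⟩
    by_contra hcon
    push Not at hcon
    have h2 : (2 : ℕ∞) ≤ ⨅ a ∈ A, G.edist v a := by
      refine le_iInf₂ fun a ha => ?_
      have hne : v ≠ a := fun e => hv (e ▸ ha)
      have h1 : (1 : ℕ∞) < G.edist v a := by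
        refine lt_of_le_of_ne ?_ ?_
        · rw [Order.one_le_iff_ne_zero]
          exact fun e => hne (SimpleGraph.edist_eq_zero_iff.1 e)
        · exact fun e => hcon a ha (SimpleGraph.edist_eq_one_iff_adj.1 e.symm)
      exact Order.add_one_le_of_lt h1
    rw [h] at h2
    exact absurd h2 (by decide)
  · rintro ⟨hv, a, ha, hadj⟩
    refine le_antisymm ?_ ?_
    · exact (iInf₂_le a ha).trans (SimpleGraph.edist_eq_one_iff_adj.2 hadj).le
    · refine le_iInf₂ fun b hb => ?_
      rw [Order.one_le_iff_ne_zero]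
      exact fun e => hv ((SimpleGraph.edist_eq_zero_iff.1 e) ▸ hb)

/-- The Cheeger constant of a finite graph: the minimum of `|∂A| / |A|` over all
`A` with `0 < |A| ≤ |V| / 2` (and `∞` if there is no such `A`). -/
def cheeger {V : Type} (G : SimpleGraph V) : ℝ≥0∞ :=
  ⨅ (A : Set V) (_ : 0 < A.ncard) (_ : 2 * A.ncard ≤ Nat.card V),
    ((vertexBoundary G A).ncard : ℝ≥0∞) / (A.ncard : ℝ≥0∞)

/-- The Cheeger constant of a finite measured graph: the minimum of `m(∂A) / m(A)` over all
`A` with `0 < m(A) ≤ m(V) / 2` (and `∞` if there is no such `A`). -/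
def measuredCheeger {V : Type} [MeasurableSpace V] (G : SimpleGraph V) (m : Measure V) : ℝ≥0∞ :=
  ⨅ (A : Set V) (_ : 0 < m A) (_ : m A ≤ m Set.univ / 2), m (vertexBoundary G A) / m A

/-! ### Finite graphs and finite measured graphs -/

/-- Finite connected (simple, undirected) graphs. -/
structure FiniteGraph where
  V : Type
  [finite : Finite V]
  graph : SimpleGraph V
  connected : graph.Connected

attribute [instance] FiniteGraph.finite

/-- Finite connected graphs with a nonzero finite measure defined on all subsets of the
vertex set. -/
structure FiniteMeasuredGraph extends FiniteGraph where
  [measurableSpace : MeasurableSpace V]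
  [discrete : DiscreteMeasurableSpace V]
  measure : Measure V
  [isFinite : IsFiniteMeasure measure]
  measure_ne_zero : measure ≠ 0

attribute [instance] FiniteMeasuredGraph.measurableSpace FiniteMeasuredGraph.discrete
  FiniteMeasuredGraph.isFinite

/-! ### Properties of sequences of graphs -/

/-- One constant bounds the number of neighbours of every vertex of every graph. -/
def UniformlyBoundedValency (G : ℕ → FiniteGraph) : Prop :=
  ∃ K : ℕ, ∀ (n : ℕ) (v : (G n).V), ((G n).graph.neighborSet v).ncard ≤ K

/-- Classical expanders. -/
def IsExpanders (G : ℕ → FiniteGraph) : Prop :=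
  UniformlyBoundedValency G ∧
    Tendsto (fun n => Nat.card (G n).V) atTop atTop ∧
    0 < ⨅ n, cheeger (G n).graph

/-- Measured expanders. -/
def IsMeasuredExpanders (G : ℕ → FiniteMeasuredGraph) : Prop :=
  0 < ⨅ n, measuredCheeger (G n).graph (G n).measure

/-- The largest relative mass of a vertex tends to zero. -/
def IsGhostly (G : ℕ → FiniteMeasuredGraph) : Prop :=
  Tendsto (fun n => ⨆ v : (G n).V, (G n).measure {v} / (G n).measure Set.univ) atTop (𝓝 0)

/-! ### Products with paths, with geometrically decaying measures -/

/-- A finite graph endowed with the normalised counting measure. -/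
def FiniteGraph.withCounting (H : FiniteGraph) : FiniteMeasuredGraph :=
  letI : MeasurableSpace H.V := ⊤
  haveI : Nonempty H.V := H.connected.nonempty
  { H with
    measure := (Nat.card H.V : ℝ≥0∞)⁻¹ • Measure.count
    isFinite := Measure.smul_finite _ (ENNReal.inv_ne_top.2 (by exact_mod_cast Nat.card_pos.ne'))
    measure_ne_zero := by
      intro h
      have h1 := congrArg (fun μ : Measure H.V => μ Set.univ) h
      simp at h1 }

/-- The measure on `V × {0, …, n}` whose restriction to the slice `V × {i}` is `2⁻ⁱ m`. -/
def geometricMeasure {V : Type} [MeasurableSpace V] (m : Measure V) (n : ℕ) :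
    Measure (V × Fin (n + 1)) :=
  ∑ i : Fin (n + 1), (2⁻¹ : ℝ≥0∞) ^ (i : ℕ) • m.map (fun v => (v, i))

/-- The Cartesian product of a finite measured graph with the path on `{0, …, n}`, with the
geometrically decaying measure. -/
def FiniteMeasuredGraph.prodPath (H : FiniteMeasuredGraph) (n : ℕ) : FiniteMeasuredGraph where
  V := H.V × Fin (n + 1)
  graph := H.graph □ SimpleGraph.pathGraph (n + 1)
  connected := H.connected.boxProd (SimpleGraph.pathGraph_connected n)
  measure := geometricMeasure H.measure n
  isFinite := by
    refine ⟨?_⟩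
    simp only [geometricMeasure, Measure.finsetSum_apply, Measure.smul_apply, smul_eq_mul]
    refine ENNReal.sum_lt_top.2 fun i _ => ENNReal.mul_lt_top (by simp) (measure_lt_top _ _)
  measure_ne_zero := by
    intro h
    have h1 := congrArg (fun μ : Measure (H.V × Fin (n + 1)) => μ Set.univ) h
    simp only [geometricMeasure, Measure.finsetSum_apply, Measure.smul_apply, smul_eq_mul,
      Measure.coe_zero, Pi.zero_apply, Finset.sum_eq_zero_iff, Finset.mem_univ, true_imp_iff] at h1
    have h2 := h1 0
    rw [Measure.map_apply (by fun_prop) MeasurableSet.univ] at h2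
    simp [H.measure_ne_zero] at h2

end MeasuredExpander

end

namespace MeasuredExpander

/-! In the product with the path, let `a i` and `b i` be the proportions of slice `i` occupied by a
set `A` and by its boundary. Vertical edges make `b` dominate the increments of `a` in both
directions. Summing these bounds with weights `2⁻ⁱ` shows that the boundary is large if the bottom
slice is sparse compared with the mass of `A`, or almost full. In the remaining range the expansion
of the factor graph in slice `0` alone suffices (`mul_geomSum_le`, `le_measuredCheeger_prodPath`).
Ordinary counting sees no decay: the bottom `k` layers are bounded by a single layer, so the Cheeger
constants of long products tend to zero (`cheeger_boxProd_pathGraph_le`).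

Expanders exist by a union bound over families of 22 permutations (`exists_expanding_perms`);
joining each point to its images gives the graph. -/

/-! ### Counting permutations and the union bound -/

open Finset in
theorem card_perm_image_eq {V : Type*} [Fintype V] [DecidableEq V] {A C : Finset V}
    (h : A.card = C.card) :
    #{σ : Equiv.Perm V | A.image σ = C} = #{σ : Equiv.Perm V | A.image σ = A} := by
  classical
  let e : {x // x ∈ A} ≃ {x // x ∈ C} := Finset.equivOfCardEq h
  -- Composition with a permutation carrying `A` onto `C` is a bijection from the stabiliser of `A`
  -- to the permutations sending `A` to `C`.
  let τ : Equiv.Perm V := e.extendSubtype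
  have hτ : A.image τ = C := by
    refine Finset.eq_of_subset_of_card_le ?_ ?_
    · intro x hx
      obtain ⟨a, ha, rfl⟩ := Finset.mem_image.1 hx
      exact e.extendSubtype_mem a ha
    · rw [Finset.card_image_of_injective _ τ.injective, h]
  symm
  refine Finset.card_bij (fun σ _ => τ * σ) ?_ ?_ ?_
  · intro σ hσ
    simp only [Finset.mem_filter, Finset.mem_univ, true_and] at hσ ⊢
    rw [Equiv.Perm.coe_mul, ← Finset.image_image, hσ, hτ]
  · intro σ _ ρ _ hh
    exact mul_left_cancel hh
  · intro σ hσ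
    simp only [Finset.mem_filter, Finset.mem_univ, true_and] at hσ
    refine ⟨τ⁻¹ * σ, ?_, by simp⟩
    simp only [Finset.mem_filter, Finset.mem_univ, true_and]
    rw [Equiv.Perm.coe_mul, ← Finset.image_image, hσ, ← hτ, Finset.image_image,
      ← Equiv.Perm.coe_mul]
    simp

open Finset in
/-- The number of permutations that map `A` into `B`. -/
theorem card_perm_image_subset_mul {V : Type*} [Fintype V] [DecidableEq V] (A B : Finset V) :
    #{σ : Equiv.Perm V | A.image σ ⊆ B} * (Fintype.card V).choose #A =
      (#B).choose #A * (Fintype.card V).factorial := by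
  have fib (D : Finset V) : #{σ : Equiv.Perm V | A.image σ ⊆ D} =
      (#D).choose #A * #{σ : Equiv.Perm V | A.image σ = A} := by
    rw [Finset.card_eq_sum_card_fiberwise (f := fun σ : Equiv.Perm V => A.image σ)
      (t := D.powersetCard #A)]
    · rw [Finset.sum_congr rfl (g := fun _ => #{σ : Equiv.Perm V | A.image σ = A})]
      · simp
      · intro C hC
        rw [Finset.mem_powersetCard] at hC
        rw [← card_perm_image_eq hC.2.symm, Finset.filter_filter]
        congr 1
        ext σ
        simp only [Finset.mem_filter, Finset.mem_univ, true_and, and_iff_right_iff_imp]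
        rintro rfl
        exact hC.1
    · intro σ hσ
      simp only [Finset.coe_filter, Finset.mem_univ, true_and, Set.mem_ofPred_eq] at hσ
      simp only [Finset.mem_coe, Finset.mem_powersetCard]
      exact ⟨hσ, Finset.card_image_of_injective _ σ.injective⟩
  -- Comparing `B` with the whole set eliminates the order of the stabiliser, which is never
  -- computed.
  have htot := fib Finset.univ
  simp only [Finset.subset_univ, Finset.filter_true, Finset.card_univ, Fintype.card_perm] at htot
  rw [fib B, htot]
  ring

/-- Each factor `(t - i) / (N - i)` of the quotient of binomials is at most `t / N`. -/
theorem choose_mul_pow_le {t N : ℕ} (h : t ≤ N) (s : ℕ) :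
    t.choose s * N ^ s ≤ N.choose s * t ^ s := by
  have key : t.descFactorial s * N ^ s ≤ N.descFactorial s * t ^ s := by
    induction s with
    | zero => simp
    | succ s ih =>
      rw [Nat.descFactorial_succ, Nat.descFactorial_succ, pow_succ, pow_succ]
      have h1 : (t - s) * N ≤ (N - s) * t := by
        rw [Nat.sub_mul, Nat.sub_mul, mul_comm N t]
        exact Nat.sub_le_sub_left (Nat.mul_le_mul_left s h) _
      calc (t - s) * t.descFactorial s * (N ^ s * N)
          = ((t - s) * N) * (t.descFactorial s * N ^ s) := by ring
        _ ≤ ((N - s) * t) * (N.descFactorial s * t ^ s) := Nat.mul_le_mul h1 ih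
        _ = _ := by ring
  rw [Nat.descFactorial_eq_factorial_mul_choose, Nat.descFactorial_eq_factorial_mul_choose,
    mul_assoc, mul_assoc] at key
  exact Nat.le_of_mul_le_mul_left key s.factorial_pos

open Finset in
theorem card_perm_image_subset_le {V : Type*} [Fintype V] [DecidableEq V] [Nonempty V]
    (A B : Finset V) :
    (#{σ : Equiv.Perm V | A.image σ ⊆ B} : ℝ) ≤
      (Fintype.card V).factorial * ((#B : ℝ) / Fintype.card V) ^ #A := by
  have hN : (0 : ℝ) < Fintype.card V := by exact_mod_cast Fintype.card_pos
  have hC : 0 < (Fintype.card V).choose #A := Nat.choose_pos (Finset.card_le_univ A)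
  rw [div_pow, ← mul_div_assoc, le_div_iff₀ (by positivity)]
  have h1 := card_perm_image_subset_mul A B
  have h2 := choose_mul_pow_le (Finset.card_le_univ B) #A
  have h3 : #{σ : Equiv.Perm V | A.image σ ⊆ B} * Fintype.card V ^ #A ≤
      (Fintype.card V).factorial * #B ^ #A := by
    refine Nat.le_of_mul_le_mul_left ?_ hC
    calc (Fintype.card V).choose #A * (#{σ : Equiv.Perm V | A.image σ ⊆ B} * Fintype.card V ^ #A)
        = (#{σ : Equiv.Perm V | A.image σ ⊆ B} * (Fintype.card V).choose #A) *
            Fintype.card V ^ #A := by ring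
      _ = (Fintype.card V).factorial * ((#B).choose #A * Fintype.card V ^ #A) := by rw [h1]; ring
      _ ≤ (Fintype.card V).factorial * ((Fintype.card V).choose #A * #B ^ #A) :=
          Nat.mul_le_mul_left _ h2
      _ = _ := by ring
  exact_mod_cast h3

theorem choose_le_three_mul_div_pow (N : ℕ) {t : ℕ} (ht : 0 < t) :
    (N.choose t : ℝ) ≤ (3 * N / t) ^ t := by
  have h1 : (N.choose t : ℝ) ≤ (N : ℝ) ^ t / t.factorial := Nat.choose_le_pow_div t N
  have h2 : (t : ℝ) ^ t / t.factorial ≤ 3 ^ t := by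
    refine (Real.pow_div_factorial_le_exp (t : ℝ) (by positivity) t).trans ?_
    rw [← Real.exp_one_pow]
    exact pow_le_pow_left₀ (Real.exp_pos _).le Real.exp_one_lt_three.le _
  refine h1.trans ?_
  have ht' : (0 : ℝ) < (t : ℝ) ^ t := by positivity
  rw [div_pow, mul_pow, le_div_iff₀ ht']
  calc (N : ℝ) ^ t / t.factorial * (t : ℝ) ^ t = ((t : ℝ) ^ t / t.factorial) * (N : ℝ) ^ t := by ring
    _ ≤ 3 ^ t * (N : ℝ) ^ t := by gcongr

/-- With `x = t / N ≤ 3/4`, the number of pairs of sets is at most `(6 / x) ^ t ≤ (6 / x) ^ (2 *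
s)`. Two of the 22 powers of `x ^ s` cancel the denominator, and the other twenty beat the factor
`36 ^ s`. -/
theorem union_bound_term_le {N s t : ℕ} (hs : 0 < s) (hst : s ≤ t) (hts : 2 * t ≤ 3 * s)
    (htN : 4 * t ≤ 3 * N) :
    (N.choose t : ℝ) * t.choose s * (((t : ℝ) / N) ^ s) ^ 22 ≤ (1 / 3) ^ s := by
  have ht : 0 < t := hs.trans_le hst
  have hN : 0 < N := by omega
  have htR : (0 : ℝ) < t := by exact_mod_cast ht
  have hNR : (0 : ℝ) < N := by exact_mod_cast hN
  set x : ℝ := (t : ℝ) / N with hx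
  have hx0 : 0 < x := by positivity
  have hx1 : x ≤ 3 / 4 := by
    rw [hx, div_le_iff₀ hNR]
    have : (4 : ℝ) * t ≤ 3 * N := by exact_mod_cast htN
    linarith
  have h1 : (N.choose t : ℝ) * t.choose s ≤ (6 / x) ^ t := by
    calc (N.choose t : ℝ) * t.choose s ≤ (3 * N / t) ^ t * 2 ^ t := by
          gcongr
          · exact choose_le_three_mul_div_pow N ht
          · exact_mod_cast Nat.choose_le_two_pow t s
      _ = (6 / x) ^ t := by
          rw [← mul_pow, hx]
          congr 1
          field_simp
          norm_num
  have h2 : (6 / x) ^ t ≤ (6 / x) ^ (2 * s) := by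
    refine pow_le_pow_right₀ ?_ (by omega)
    rw [le_div_iff₀ hx0]
    linarith
  calc (N.choose t : ℝ) * t.choose s * (x ^ s) ^ 22 ≤ (6 / x) ^ (2 * s) * (x ^ s) ^ 22 := by
        gcongr
        exact h1.trans h2
    _ = (36 * x ^ 20) ^ s := by
        rw [pow_mul, pow_right_comm x s 22, ← mul_pow]
        congr 1
        field_simp
        norm_num
    _ ≤ (1 / 3) ^ s := by
        gcongr
        calc 36 * x ^ 20 ≤ 36 * (3 / 4 : ℝ) ^ 20 := by gcongr
          _ ≤ 1 / 3 := by norm_num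

theorem sum_third_pow_lt_one (M : ℕ) : ∑ s ∈ Finset.Icc 1 M, (1 / 3 : ℝ) ^ s < 1 := by
  have h : ∑ s ∈ Finset.Icc 1 M, (1 / 3 : ℝ) ^ s = 1 / 2 - 1 / 2 * (1 / 3) ^ M := by
    induction M with
    | zero => simp
    | succ M ih =>
      rw [Finset.sum_Icc_succ_top (by omega), ih]
      ring
  rw [h]
  have : (0 : ℝ) < (1 / 3) ^ M := by positivity
  linarith

open Finset in
/-- Some family of `22` permutations expands all sets of at most half of the points. -/
theorem exists_expanding_perms (V : Type*) [Fintype V] [DecidableEq V] [Nonempty V] :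
    ∃ π : Fin 22 → Equiv.Perm V, ∀ A B : Finset V, 0 < #A → 2 * #A ≤ Fintype.card V →
      A ⊆ B → (∀ j, A.image (π j) ⊆ B) → 3 * #A < 2 * #B := by
  classical
  set N := Fintype.card V with hN
  -- The largest size of `B` that violates the conclusion for `#A = s`. A smaller violating `B` can
  -- be enlarged to this size, so only one size per `s` enters the union bound.
  let t : ℕ → ℕ := fun s => 3 * s / 2
  let bad (A B : Finset V) : Finset (Fin 22 → Equiv.Perm V) :=
    Fintype.piFinset fun _ => {σ : Equiv.Perm V | A.image σ ⊆ B}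
  let allBad : Finset (Fin 22 → Equiv.Perm V) :=
    (Icc 1 (N / 2)).biUnion fun s =>
      (powersetCard (t s) univ).biUnion fun B => (B.powersetCard s).biUnion fun A => bad A B
  have hF : (0 : ℝ) < N.factorial := by exact_mod_cast N.factorial_pos
  have hcard : (#allBad : ℝ) < (N.factorial : ℝ) ^ 22 := by
    calc (#allBad : ℝ)
        ≤ ∑ s ∈ Icc 1 (N / 2), ∑ B ∈ powersetCard (t s) (univ : Finset V),
            ∑ A ∈ B.powersetCard s, (#(bad A B) : ℝ) := by
          have : #allBad ≤ ∑ s ∈ Icc 1 (N / 2), ∑ B ∈ powersetCard (t s) (univ : Finset V),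
            ∑ A ∈ B.powersetCard s, #(bad A B) :=
            card_biUnion_le.trans (sum_le_sum fun s _ =>
              card_biUnion_le.trans (sum_le_sum fun B _ => card_biUnion_le))
          exact_mod_cast this
      _ ≤ ∑ s ∈ Icc 1 (N / 2), ∑ B ∈ powersetCard (t s) (univ : Finset V),
            ∑ A ∈ B.powersetCard s, ((N.factorial : ℝ) * ((t s : ℝ) / N) ^ s) ^ 22 := by
          refine sum_le_sum fun s _ => sum_le_sum fun B hB => sum_le_sum fun A hA => ?_
          have h1 : #(bad A B) = #{σ : Equiv.Perm V | A.image σ ⊆ B} ^ 22 := by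
            simp [bad]
          rw [h1, Nat.cast_pow]
          have h2 := card_perm_image_subset_le A B
          rw [(mem_powersetCard.1 hA).2, (mem_powersetCard.1 hB).2] at h2
          exact pow_le_pow_left₀ (by positivity) h2 _
      _ = ∑ s ∈ Icc 1 (N / 2), (N.factorial : ℝ) ^ 22 *
            ((N.choose (t s) : ℝ) * (t s).choose s * (((t s : ℝ) / N) ^ s) ^ 22) := by
          refine sum_congr rfl fun s _ => ?_
          rw [sum_congr rfl (g := fun _ => ((t s).choose s : ℝ) *
            ((N.factorial : ℝ) * ((t s : ℝ) / N) ^ s) ^ 22)]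
          · rw [sum_const, card_powersetCard, card_univ, nsmul_eq_mul, mul_pow]
            ring
          · intro B hB
            rw [sum_const, card_powersetCard, (mem_powersetCard.1 hB).2, nsmul_eq_mul]
      _ ≤ ∑ s ∈ Icc 1 (N / 2), (N.factorial : ℝ) ^ 22 * (1 / 3) ^ s := by
          refine sum_le_sum fun s hs => ?_
          rw [mem_Icc] at hs
          have := union_bound_term_le (N := N) (s := s) (t := t s) (by omega)
            (by simp only [t]; omega) (by simp only [t]; omega) (by simp only [t]; omega)
          gcongr
      _ = (N.factorial : ℝ) ^ 22 * ∑ s ∈ Icc 1 (N / 2), (1 / 3 : ℝ) ^ s := by rw [mul_sum]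
      _ < (N.factorial : ℝ) ^ 22 * 1 := by
          have := sum_third_pow_lt_one (N / 2)
          gcongr
      _ = _ := mul_one _
  obtain ⟨π, hπ⟩ : ∃ π, π ∉ allBad := by
    by_contra! h
    have : allBad = univ := eq_univ_iff_forall.2 h
    rw [this] at hcard
    simp [Fintype.card_perm, ← hN] at hcard
  refine ⟨π, fun A B hA hA2 hAB hB => ?_⟩
  by_contra! hlt
  obtain ⟨B', hBB', -, hB'⟩ := exists_subsuperset_card_eq (n := t #A) (subset_univ B)
    (by simp only [t]; omega) (by rw [card_univ]; simp only [t]; omega)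
  refine hπ ?_
  simp only [allBad, mem_biUnion]
  refine ⟨#A, by rw [mem_Icc]; omega, B', by simp [mem_powersetCard, hB'], A, ?_, ?_⟩
  · rw [mem_powersetCard]
    exact ⟨hAB.trans hBB', rfl⟩
  · simp only [bad, Fintype.mem_piFinset, mem_filter, mem_univ, true_and]
    exact fun j => (hB j).trans hBB'

/-! ### From expanding permutations to expander graphs -/

theorem coe_le_cheeger_iff {V : Type} [Finite V] (G : SimpleGraph V) (c : NNReal) :
    (c : ℝ≥0∞) ≤ cheeger G ↔ ∀ A : Set V, 0 < A.ncard → 2 * A.ncard ≤ Nat.card V →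
      (c : ℝ) * A.ncard ≤ (vertexBoundary G A).ncard := by
  simp only [cheeger, le_iInf_iff]
  refine forall_congr' fun A => forall_congr' fun h0 => forall_congr' fun _ => ?_
  rw [ENNReal.le_div_iff_mul_le (Or.inl (by exact_mod_cast h0.ne'))
    (Or.inl (ENNReal.natCast_ne_top _))]
  rw [← ENNReal.coe_natCast, ← ENNReal.coe_natCast, ← ENNReal.coe_mul, ENNReal.coe_le_coe,
    ← NNReal.coe_le_coe]
  simp

/-- Vertex expansion forces connectedness. -/
theorem connected_of_vertexBoundary_nonempty {V : Type} [Finite V] [Nonempty V]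
    (G : SimpleGraph V)
    (h : ∀ A : Set V, 0 < A.ncard → 2 * A.ncard ≤ Nat.card V → (vertexBoundary G A).Nonempty) :
    G.Connected := by
  refine ⟨fun u v => ?_⟩
  by_contra huv
  let A : Set V := {w | G.Reachable u w}
  have hu : u ∈ A := SimpleGraph.Reachable.refl u
  have hclosed : ∀ x y, G.Adj x y → (x ∈ A ↔ y ∈ A) := fun x y hxy =>
    ⟨fun hx => SimpleGraph.Reachable.trans hx hxy.reachable,
      fun hy => SimpleGraph.Reachable.trans hy hxy.symm.reachable⟩
  have hsum := Set.ncard_add_ncard_compl A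
  have hA : 0 < A.ncard := (Set.ncard_pos).2 ⟨u, hu⟩
  have hAc : 0 < Aᶜ.ncard := (Set.ncard_pos).2 ⟨v, huv⟩
  -- A component and its complement both have empty boundary, and one of them is small enough for
  -- `h`.
  rcases le_total A.ncard Aᶜ.ncard with hle | hle
  · obtain ⟨x, hx⟩ := h A hA (by omega)
    obtain ⟨hx, a, ha, hxa⟩ := (mem_vertexBoundary_iff G A x).1 hx
    exact hx ((hclosed x a hxa).2 ha)
  · obtain ⟨x, hx⟩ := h Aᶜ hAc (by omega)
    obtain ⟨hx, a, ha, hxa⟩ := (mem_vertexBoundary_iff G _ x).1 hx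
    exact ha ((hclosed x a hxa).1 (not_not.1 hx))

/-- The simple graph that joins `v` to `π j v` for every `j`. -/
def permGraph {V : Type} {k : ℕ} (π : Fin k → Equiv.Perm V) : SimpleGraph V :=
  SimpleGraph.fromRel fun u v => ∃ j, π j u = v

theorem ncard_neighborSet_permGraph_le {V : Type} [Finite V] {k : ℕ} (π : Fin k → Equiv.Perm V)
    (v : V) : ((permGraph π).neighborSet v).ncard ≤ 2 * k := by
  have hsub : (permGraph π).neighborSet v ⊆
      Set.range (fun j => π j v) ∪ Set.range (fun j => (π j).symm v) := by
    intro w hw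
    rw [SimpleGraph.mem_neighborSet, permGraph, SimpleGraph.fromRel_adj] at hw
    rcases hw.2 with ⟨j, hj⟩ | ⟨j, hj⟩
    · exact Or.inl ⟨j, hj⟩
    · exact Or.inr ⟨j, by simp [← hj]⟩
  have hrange (f : Fin k → V) : (Set.range f).ncard ≤ k := by
    rw [← Set.image_univ]
    refine (Set.ncard_image_le).trans ?_
    simp [Set.ncard_univ]
  calc _ ≤ _ := Set.ncard_le_ncard hsub
    _ ≤ _ := Set.ncard_union_le _ _
    _ ≤ 2 * k := by rw [two_mul]; exact add_le_add (hrange _) (hrange _)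

theorem exists_permGraph_expanding (V : Type) [Finite V] [Nonempty V] :
    ∃ π : Fin 22 → Equiv.Perm V, ∀ A : Set V, 0 < A.ncard → 2 * A.ncard ≤ Nat.card V →
      A.ncard < 2 * (vertexBoundary (permGraph π) A).ncard := by
  classical
  have := Fintype.ofFinite V
  obtain ⟨π, hπ⟩ := exists_expanding_perms V
  refine ⟨π, fun A hA hA2 => ?_⟩
  have hsub : ∀ j, ∀ a ∈ A, π j a ∈ A ∪ vertexBoundary (permGraph π) A := by
    intro j a ha
    by_cases h : π j a ∈ A
    · exact Or.inl h
    · refine Or.inr ((mem_vertexBoundary_iff _ _ _).2 ⟨h, a, ha, ?_⟩)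
      rw [permGraph, SimpleGraph.fromRel_adj]
      exact ⟨fun e => h (by rwa [e]), Or.inr ⟨j, rfl⟩⟩
  -- Every `π j` maps `A` into `A ∪ ∂A`, so `3|A| < 2|A ∪ ∂A| ≤ 2|A| + 2|∂A|`.
  have hcard := hπ A.toFinset (A ∪ vertexBoundary (permGraph π) A).toFinset
    (by rwa [← Set.ncard_eq_toFinset_card'])
    (by rwa [← Set.ncard_eq_toFinset_card', ← Nat.card_eq_fintype_card])
    (by rw [Set.toFinset_subset_toFinset]; exact Set.subset_union_left)
    (by
      intro j x hx
      obtain ⟨a, ha, rfl⟩ := Finset.mem_image.1 hx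
      rw [Set.mem_toFinset] at ha ⊢
      exact hsub j a ha)
  rw [← Set.ncard_eq_toFinset_card', ← Set.ncard_eq_toFinset_card'] at hcard
  have := Set.ncard_union_le A (vertexBoundary (permGraph π) A)
  omega

theorem exists_isExpanders : ∃ H : ℕ → FiniteGraph, IsExpanders H := by
  choose π hπ using fun n : ℕ => exists_permGraph_expanding (Fin (n + 1))
  refine ⟨fun n =>
    { V := Fin (n + 1)
      graph := permGraph (π n)
      connected := connected_of_vertexBoundary_nonempty _ fun A h0 h1 => ?_ }, ⟨2 * 22, ?_⟩, ?_, ?_⟩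
  · rw [← Set.ncard_pos]
    have := hπ n A h0 h1
    omega
  · exact fun n v => ncard_neighborSet_permGraph_le (π n) v
  · simpa using tendsto_add_atTop_nat 1
  · refine lt_of_lt_of_le (b := ((1 / 2 : NNReal) : ℝ≥0∞)) (by simp) (le_iInf fun n => ?_)
    rw [coe_le_cheeger_iff]
    intro A h0 h1
    have h2 : (A.ncard : ℝ) < 2 * (vertexBoundary (permGraph (π n)) A).ncard := by
      exact_mod_cast hπ n A h0 h1
    push_cast
    linarith

theorem coe_le_measuredCheeger_iff {V : Type} [MeasurableSpace V] (G : SimpleGraph V)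
    (m : Measure V) [IsFiniteMeasure m] (c : NNReal) :
    (c : ℝ≥0∞) ≤ measuredCheeger G m ↔ ∀ A : Set V, 0 < m.real A →
      m.real A ≤ m.real Set.univ / 2 → (c : ℝ) * m.real A ≤ m.real (vertexBoundary G A) := by
  simp only [measuredCheeger, le_iInf_iff]
  refine forall_congr' fun A => ?_
  have h1 : 0 < m A ↔ 0 < m.real A := by
    rw [Measure.real, ENNReal.toReal_pos_iff]
    simp
  have h2 : m A ≤ m Set.univ / 2 ↔ m.real A ≤ m.real Set.univ / 2 := by
    have hfin : m Set.univ / 2 ≠ ∞ := ENNReal.div_ne_top (measure_ne_top _ _) (by simp)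
    rw [← ENNReal.toReal_le_toReal (measure_ne_top _ _) hfin]
    simp [Measure.real]
  rw [h1, h2]
  refine forall_congr' fun h0 => forall_congr' fun _ => ?_
  rw [ENNReal.le_div_iff_mul_le (Or.inl (h1.2 h0).ne') (Or.inl (measure_ne_top _ _)),
    ← ENNReal.toReal_le_toReal (ENNReal.mul_ne_top ENNReal.coe_ne_top (measure_ne_top _ _))
      (measure_ne_top _ _)]
  simp [Measure.real]

/-! ### Sums with geometrically decaying weights -/

/-- The sum of `2⁻ⁱ a i` over `i ≤ n`. -/
noncomputable def geomSum (a : ℕ → ℝ) (n : ℕ) : ℝ := ∑ i ∈ Finset.range (n + 1), (1 / 2) ^ i * a i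

theorem geomSum_one (n : ℕ) : geomSum (fun _ => 1) n = 2 - (1 / 2) ^ n := by
  induction n with
  | zero => norm_num [geomSum]
  | succ n ih =>
    rw [geomSum, Finset.sum_range_succ, ← geomSum, ih]
    ring

theorem head_le_geomSum {b : ℕ → ℝ} (hb : ∀ i, 0 ≤ b i) (n : ℕ) : b 0 ≤ geomSum b n := by
  have := Finset.single_le_sum (s := Finset.range (n + 1)) (f := fun i => (1 / 2 : ℝ) ^ i * b i)
    (fun i _ => mul_nonneg (by positivity) (hb i)) (Finset.mem_range.2 n.succ_pos)
  simpa [geomSum] using this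

/-- Summation by parts: the left side is the sum of `2⁻ⁱ (a (i + 1) - a i)` over `i < n`. It is
useful when `a 0` is small compared with the weighted sum. -/
theorem geomSum_sub_le {a b : ℕ → ℝ} {n : ℕ} (h : ∀ i < n, a (i + 1) - a i ≤ b i) :
    geomSum a n - 2 * a 0 + (1 / 2) ^ n * a n ≤ geomSum b n - (1 / 2) ^ n * b n := by
  induction n with
  | zero => norm_num [geomSum]; linarith
  | succ n ih =>
    have ih := ih fun i hi => h i (by omega)
    have h1 := mul_le_mul_of_nonneg_left (h n n.lt_succ_self) (by positivity : (0 : ℝ) ≤ (1 / 2) ^ n)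
    rw [geomSum, geomSum, Finset.sum_range_succ, Finset.sum_range_succ _ (n + 1), ← geomSum,
      ← geomSum, pow_succ]
    linarith

/-- The same summation for decrements, with weights `2⁻⁽ⁱ⁺¹⁾`. It is useful when `a 0` is close to
`1`, since a set of at most half the mass cannot stay nearly full above. -/
theorem sub_geomSum_le {a b : ℕ → ℝ} {n : ℕ} (h0 : 0 ≤ b 0)
    (h : ∀ i < n, a i - a (i + 1) ≤ b (i + 1)) :
    a 0 - geomSum a n / 2 - (1 / 2) ^ n * a n / 2 ≤ geomSum b n := by
  induction n with
  | zero => norm_num [geomSum]; linarith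
  | succ n ih =>
    have ih := ih fun i hi => h i (by omega)
    have h1 := mul_le_mul_of_nonneg_left (h n n.lt_succ_self)
      (by positivity : (0 : ℝ) ≤ (1 / 2) ^ (n + 1))
    rw [geomSum, geomSum, Finset.sum_range_succ, Finset.sum_range_succ _ (n + 1), ← geomSum,
      ← geomSum]
    rw [pow_succ] at h1 ⊢
    linarith

/-- If `a i` and `b i` are the proportions of the slices of a set and of its boundary, then the
weighted boundary is a definite proportion of the weighted set. -/
theorem mul_geomSum_le {a b : ℕ → ℝ} {n : ℕ} {c : ℝ} (hc0 : 0 ≤ c) (hc1 : c ≤ 1)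
    (ha1 : ∀ i, a i ≤ 1) (hb : ∀ i, 0 ≤ b i)
    (hdown : ∀ i < n, a (i + 1) - a i ≤ b i) (hup : ∀ i < n, a i - a (i + 1) ≤ b (i + 1))
    (hsmall : a 0 ≤ 1 / 2 → c * a 0 ≤ b 0)
    (hlarge : 1 / 2 ≤ a 0 → c * (1 - a 0) ≤ (1 + c) * b 0)
    (ha : 0 ≤ a n) (hM0 : 0 ≤ geomSum a n) (hM : geomSum a n ≤ (2 - (1 / 2) ^ n) / 2) :
    c / 16 * geomSum a n ≤ geomSum b n := by
  have h1 := geomSum_sub_le hdown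
  have h2 := sub_geomSum_le (hb 0) hup
  have h3 := head_le_geomSum hb n
  have hq0 : (0 : ℝ) < (1 / 2) ^ n := by positivity
  have hq1 : ((1 : ℝ) / 2) ^ n ≤ 1 := pow_le_one₀ (by norm_num) (by norm_num)
  have hqa : (1 / 2 : ℝ) ^ n * a n ≤ (1 / 2) ^ n := mul_le_of_le_one_right hq0.le (ha1 n)
  have hqa0 : 0 ≤ (1 / 2 : ℝ) ^ n * a n := mul_nonneg hq0.le ha
  have hqb0 : 0 ≤ (1 / 2 : ℝ) ^ n * b n := mul_nonneg hq0.le (hb n)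
  set M := geomSum a n
  set B := geomSum b n
  have hcM : c * M ≤ M := mul_le_of_le_one_left hM0 hc1
  -- Sparse bottom slice: `h1` gives `B ≥ M - 2 * a 0 ≥ M / 2`.
  rcases le_total (a 0) (M / 4) with h | h
  · linarith
  have hcM' : c * M ≤ 4 * (c * a 0) := by
    have := mul_le_mul_of_nonneg_left h hc0
    linarith
  have hcMnn : 0 ≤ c * M := mul_nonneg hc0 hM0
  rcases le_total (a 0) (1 / 2) with h' | h'
  · have := hsmall h'
    linarith
  -- Up to `7/8`, expansion of the complement gives `c / 8 ≤ 2 * b 0`; as `M ≤ 1`, this is where the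
  -- constant `16` arises. Beyond `7/8`, `h2` gives `B ≥ 1/8`.
  rcases le_total (a 0) (7 / 8) with h'' | h''
  · have h4 := hlarge h'
    have h5 : c * b 0 ≤ b 0 := mul_le_of_le_one_left (hb 0) hc1
    have h6 : c * (1 / 8) ≤ c * (1 - a 0) := mul_le_mul_of_nonneg_left (by linarith) hc0
    have h7 : c * M ≤ c * 1 := mul_le_mul_of_nonneg_left (by linarith) hc0
    linarith
  · linarith

/-! ### Slices of subsets of a product with a path -/

/-- The slice of `A` at height `i`. -/
def slice {W : Type} {n : ℕ} (A : Set (W × Fin (n + 1))) (i : ℕ) : Set W :=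
  {w | ∃ h : i < n + 1, (w, ⟨i, h⟩) ∈ A}

theorem geometricMeasure_apply {V : Type} [Finite V] [MeasurableSpace V]
    [DiscreteMeasurableSpace V] (m : Measure V) (n : ℕ) (A : Set (V × Fin (n + 1))) :
    geometricMeasure m n A = ∑ i : Fin (n + 1), (2⁻¹ : ℝ≥0∞) ^ (i : ℕ) * m (slice A i) := by
  simp only [geometricMeasure, Measure.finsetSum_apply, Measure.smul_apply, smul_eq_mul]
  refine Finset.sum_congr rfl fun i _ => ?_
  have hs : (fun v : V => (v, i)) ⁻¹' A = slice A i := by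
    ext w
    simp [slice, i.isLt]
  rw [Measure.map_apply (by fun_prop) MeasurableSet.of_discrete, hs]

theorem withCounting_measure_apply (H : FiniteGraph) (S : Set H.V) :
    H.withCounting.measure S = (Nat.card H.V : ℝ≥0∞)⁻¹ * (S.ncard : ℝ≥0∞) := by
  let : MeasurableSpace H.V := ⊤
  change ((Nat.card H.V : ℝ≥0∞)⁻¹ • (Measure.count : Measure H.V)) S = _
  rw [Measure.smul_apply, smul_eq_mul, Measure.count_apply_finite S (Set.toFinite S),
    Set.ncard_eq_toFinset_card S (Set.toFinite S)]

theorem prodPath_measure_apply (H : FiniteGraph) (n : ℕ)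
    (A : Set (H.V × Fin (n + 1))) :
    (H.withCounting.prodPath n).measure A = ∑ i : Fin (n + 1), (2⁻¹ : ℝ≥0∞) ^ (i : ℕ) *
      ((Nat.card H.V : ℝ≥0∞)⁻¹ * ((slice A i).ncard : ℝ≥0∞)) := by
  refine (geometricMeasure_apply H.withCounting.measure n A).trans ?_
  exact Finset.sum_congr rfl fun i _ => congrArg _ (withCounting_measure_apply H _)

theorem prodPath_measure_real (H : FiniteGraph) (n : ℕ)
    (A : Set (H.V × Fin (n + 1))) :
    (H.withCounting.prodPath n).measure.real A =
      geomSum (fun i => ((slice A i).ncard : ℝ) / Nat.card H.V) n := by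
  have : Nonempty H.V := H.connected.nonempty
  refine (congrArg ENNReal.toReal (prodPath_measure_apply H n A)).trans ?_
  rw [ENNReal.toReal_sum, geomSum, ← Fin.sum_univ_eq_sum_range
    (fun i => (1 / 2 : ℝ) ^ i * (((slice A i).ncard : ℝ) / Nat.card H.V))]
  · refine Finset.sum_congr rfl fun i _ => ?_
    simp [div_eq_inv_mul]
  · intro i _
    refine ENNReal.mul_ne_top (by simp) (ENNReal.mul_ne_top ?_ (ENNReal.natCast_ne_top _))
    exact ENNReal.inv_ne_top.2 (by exact_mod_cast Nat.card_pos.ne')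

section Slices

variable {W : Type} (G : SimpleGraph W) {n : ℕ} (A : Set (W × Fin (n + 1)))

theorem vertexBoundary_slice_subset (i : ℕ) :
    vertexBoundary G (slice A i) ⊆
      slice (vertexBoundary (G □ SimpleGraph.pathGraph (n + 1)) A) i := by
  intro w hw
  obtain ⟨hw, a, ⟨hi, ha⟩, hwa⟩ := (mem_vertexBoundary_iff _ _ _).1 hw
  refine ⟨hi, (mem_vertexBoundary_iff _ _ _).2 ⟨fun h => hw ⟨hi, h⟩, _, ha, ?_⟩⟩
  rw [SimpleGraph.boxProd_adj]
  exact Or.inl ⟨hwa, rfl⟩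

theorem slice_succ_diff_subset {i : ℕ} (hi : i < n) :
    slice A (i + 1) \ slice A i ⊆
      slice (vertexBoundary (G □ SimpleGraph.pathGraph (n + 1)) A) i := by
  rintro w ⟨⟨h, hw⟩, hw'⟩
  refine ⟨by omega, (mem_vertexBoundary_iff _ _ _).2 ⟨fun h => hw' ⟨_, h⟩, _, hw, ?_⟩⟩
  rw [SimpleGraph.boxProd_adj, SimpleGraph.pathGraph_adj]
  exact Or.inr ⟨Or.inl rfl, rfl⟩

theorem slice_diff_succ_subset {i : ℕ} (hi : i < n) :
    slice A i \ slice A (i + 1) ⊆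
      slice (vertexBoundary (G □ SimpleGraph.pathGraph (n + 1)) A) (i + 1) := by
  rintro w ⟨⟨h, hw⟩, hw'⟩
  refine ⟨by omega, (mem_vertexBoundary_iff _ _ _).2 ⟨fun h => hw' ⟨_, h⟩, _, hw, ?_⟩⟩
  rw [SimpleGraph.boxProd_adj, SimpleGraph.pathGraph_adj]
  exact Or.inr ⟨Or.inr rfl, rfl⟩

end Slices

/-! ### Measured expansion of the products -/

/-- Expansion of small sets controls the boundaries of large sets. -/
theorem mul_card_sub_le_of_le_cheeger {W : Type} [Finite W] (G : SimpleGraph W) {c : ℝ}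
    (h : ∀ A : Set W, 0 < A.ncard → 2 * A.ncard ≤ Nat.card W →
      c * A.ncard ≤ (vertexBoundary G A).ncard)
    (A : Set W) (hA : Nat.card W ≤ 2 * A.ncard) :
    c * (Nat.card W - A.ncard) ≤ (1 + c) * (vertexBoundary G A).ncard := by
  -- The boundary of `B` lies in `∂A`, and the complement of `A` is the disjoint union of `∂A` and
  -- `B`. So bounding `c|B|` by `|∂A|` suffices.
  set B := (A ∪ vertexBoundary G A)ᶜ with hB
  have hsum := Set.ncard_add_ncard_compl (A ∪ vertexBoundary G A)
  have hun : (A ∪ vertexBoundary G A).ncard = A.ncard + (vertexBoundary G A).ncard :=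
    Set.ncard_union_eq (Set.disjoint_left.2 fun x hx hx' =>
      ((mem_vertexBoundary_iff _ _ _).1 hx').1 hx)
  have hsub : vertexBoundary G B ⊆ vertexBoundary G A := by
    intro v hv
    obtain ⟨hv, b, hb, hvb⟩ := (mem_vertexBoundary_iff _ _ _).1 hv
    rcases not_not.1 hv with hv | hv
    · by_cases hbA : b ∈ A
      · exact absurd (Or.inl hbA) hb
      · exact absurd (Or.inr ((mem_vertexBoundary_iff _ _ _).2 ⟨hbA, v, hv, hvb.symm⟩)) hb
    · exact hv
  have hle : c * B.ncard ≤ (vertexBoundary G A).ncard := by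
    rcases Nat.eq_zero_or_pos B.ncard with h0 | h0
    · rw [h0]
      simp
    · refine (h B h0 (by rw [hB]; omega)).trans ?_
      exact_mod_cast Set.ncard_le_ncard hsub
  have hR : (Nat.card W : ℝ) - A.ncard = (vertexBoundary G A).ncard + B.ncard := by
    rw [← hsum, hun]
    push_cast
    ring
  rw [hR]
  linarith

theorem le_measuredCheeger_prodPath (H : FiniteGraph) (n : ℕ) {c : NNReal} (hc1 : c ≤ 1)
    (hc : (c : ℝ≥0∞) ≤ cheeger H.graph) :
    ((c / 16 : NNReal) : ℝ≥0∞) ≤ measuredCheeger (H.withCounting.prodPath n).graph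
      (H.withCounting.prodPath n).measure := by
  rw [coe_le_cheeger_iff] at hc
  rw [coe_le_measuredCheeger_iff]
  intro (A : Set (H.V × Fin (n + 1))) hA hA2
  have hW : Nonempty H.V := H.connected.nonempty
  have hN : (0 : ℝ) < Nat.card H.V := by exact_mod_cast Nat.card_pos
  have huniv : (H.withCounting.prodPath n).measure.real Set.univ = 2 - (1 / 2) ^ n := by
    refine (prodPath_measure_real H n Set.univ).trans ?_
    rw [← geomSum_one]
    refine Finset.sum_congr rfl fun i hi => ?_
    have : slice (Set.univ : Set (H.V × Fin (n + 1))) i = Set.univ := by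
      ext w
      simpa [slice, Nat.lt_succ_iff] using hi
    simp only [this, Set.ncard_univ]
    rw [div_self hN.ne']
  rw [huniv] at hA2
  have hMA := prodPath_measure_real H n A
  set D : Set (H.V × Fin (n + 1)) := vertexBoundary (H.graph □ SimpleGraph.pathGraph (n + 1)) A
  have hMD : (H.withCounting.prodPath n).measure.real (vertexBoundary
      (H.withCounting.prodPath n).graph A) =
        geomSum (fun i => ((slice D i).ncard : ℝ) / Nat.card H.V) n :=
    prodPath_measure_real H n D
  rw [hMA] at hA hA2
  rw [hMA, hMD]
  have hdiff {S T U : Set H.V} (h : S \ T ⊆ U) :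
      (S.ncard : ℝ) / Nat.card H.V - T.ncard / Nat.card H.V ≤ U.ncard / Nat.card H.V := by
    rw [← sub_div]
    gcongr
    have h1 : S.ncard ≤ U.ncard + T.ncard :=
      (Set.ncard_le_ncard (fun x hx => by
        by_cases hT : x ∈ T
        · exact Or.inr hT
        · exact Or.inl (h ⟨hx, hT⟩))).trans (Set.ncard_union_le U T)
    have h2 : (S.ncard : ℝ) ≤ U.ncard + T.ncard := by exact_mod_cast h1
    linarith
  have hb0 : ((vertexBoundary H.graph (slice A 0)).ncard : ℝ) ≤ (slice D 0).ncard := by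
    exact_mod_cast Set.ncard_le_ncard (vertexBoundary_slice_subset H.graph A 0)
  push_cast
  refine mul_geomSum_le (a := fun i => ((slice A i).ncard : ℝ) / Nat.card H.V)
    (b := fun i => ((slice D i).ncard : ℝ) / Nat.card H.V) c.2 (by exact_mod_cast hc1) ?_
    (fun i => by positivity) (fun i hi => hdiff (slice_succ_diff_subset H.graph A hi))
    (fun i hi => hdiff (slice_diff_succ_subset H.graph A hi)) ?_ ?_ (by positivity) hA.le hA2
  · intro i
    rw [div_le_one hN]
    exact_mod_cast Set.ncard_le_card _
  · intro h
    rw [div_le_iff₀ hN] at h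
    rw [← mul_div_assoc]
    gcongr
    refine le_trans ?_ hb0
    -- The bottom slice may be empty although `A` is not; `hc` covers only nonempty sets.
    rcases Nat.eq_zero_or_pos (slice A 0).ncard with h0 | h0
    · rw [h0]
      simp
    · refine hc _ h0 ?_
      have : (2 : ℝ) * (slice A 0).ncard ≤ Nat.card H.V := by linarith
      exact_mod_cast this
  · intro h
    rw [le_div_iff₀ hN] at h
    have h1 : Nat.card H.V ≤ 2 * (slice A 0).ncard := by
      have : (Nat.card H.V : ℝ) ≤ 2 * (slice A 0).ncard := by linarith
      exact_mod_cast this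
    have h2 := mul_card_sub_le_of_le_cheeger H.graph hc (slice A 0) h1
    have h3 := mul_le_mul_of_nonneg_left hb0 (add_nonneg zero_le_one c.2)
    rw [one_sub_div hN.ne', ← mul_div_assoc, ← mul_div_assoc]
    exact div_le_div_of_nonneg_right (h2.trans h3) hN.le

theorem isMeasuredExpanders_prodPath {H : ℕ → FiniteGraph} (hH : IsExpanders H) :
    IsMeasuredExpanders fun n => (H n).withCounting.prodPath n := by
  obtain ⟨c, hc0, hc⟩ := ENNReal.lt_iff_exists_nnreal_btwn.1 hH.2.2
  -- The slice estimate needs a constant at most `1`, hence the truncation.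
  have hpos : (0 : ℝ≥0∞) < ((min c 1 / 16 : NNReal) : ℝ≥0∞) := by
    have : 0 < c := by exact_mod_cast hc0
    rw [ENNReal.coe_pos]
    positivity
  refine hpos.trans_le (le_iInf fun n => le_measuredCheeger_prodPath _ _ (min_le_right _ _) ?_)
  calc ((min c 1 : NNReal) : ℝ≥0∞) ≤ c := by exact_mod_cast min_le_left _ _
    _ ≤ _ := hc.le.trans (iInf_le _ n)

/-! ### Ghostliness, valency and failure of ordinary expansion -/

theorem one_le_prodPath_measure_univ (H : FiniteGraph) (n : ℕ) :
    1 ≤ (H.withCounting.prodPath n).measure Set.univ := by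
  have : Nonempty H.V := H.connected.nonempty
  refine le_trans ?_ (prodPath_measure_apply H n Set.univ).ge
  -- The bottom slice alone has mass `1`.
  refine le_trans ?_ (Finset.single_le_sum (fun _ _ => zero_le) (Finset.mem_univ 0))
  have h : slice (Set.univ : Set (H.V × Fin (n + 1))) ((0 : Fin (n + 1)) : ℕ) =
      (Set.univ : Set H.V) := by
    ext w
    simp [slice]
  rw [h, Set.ncard_univ, ENNReal.inv_mul_cancel (by exact_mod_cast Nat.card_pos.ne')
    (ENNReal.natCast_ne_top _)]
  simp

theorem prodPath_measure_singleton_le (H : FiniteGraph) (n : ℕ)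
    (v : (H.withCounting.prodPath n).V) :
    (H.withCounting.prodPath n).measure {v} ≤ (Nat.card H.V : ℝ≥0∞)⁻¹ := by
  obtain ⟨w, i⟩ : H.V × Fin (n + 1) := v
  refine (prodPath_measure_apply H n {(w, i)}).trans_le ?_
  rw [Finset.sum_eq_single i]
  · have h : slice ({(w, i)} : Set (H.V × Fin (n + 1))) i = {w} := by
      ext x
      simp [slice, i.isLt]
    rw [h, Set.ncard_singleton, Nat.cast_one, mul_one]
    exact mul_le_of_le_one_left' (pow_le_one₀ zero_le (by simp))
  · intro j _ hj
    have h : slice ({(w, i)} : Set (H.V × Fin (n + 1))) j = ∅ := by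
      ext x
      simp [slice, j.isLt, hj]
    simp [h]
  · simp

theorem isGhostly_prodPath {H : ℕ → FiniteGraph}
    (hH : Tendsto (fun n => Nat.card (H n).V) atTop atTop) :
    IsGhostly fun n => (H n).withCounting.prodPath n := by
  have hlim : Tendsto (fun n => (Nat.card (H n).V : ℝ≥0∞)⁻¹) atTop (𝓝 0) :=
    ENNReal.tendsto_inv_nat_nhds_zero.comp hH
  refine tendsto_of_tendsto_of_tendsto_of_le_of_le tendsto_const_nhds hlim
    (fun n => zero_le) fun n => iSup_le fun v => ?_
  refine ENNReal.div_le_of_le_mul ((prodPath_measure_singleton_le (H n) n v).trans ?_)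
  exact le_mul_of_one_le_right' (one_le_prodPath_measure_univ (H n) n)

theorem uniformlyBoundedValency_prodPath {H : ℕ → FiniteGraph} (hH : UniformlyBoundedValency H) :
    UniformlyBoundedValency fun n => ((H n).withCounting.prodPath n).toFiniteGraph := by
  obtain ⟨K, hK⟩ := hH
  refine ⟨K + 2, fun n v => ?_⟩
  obtain ⟨w, i⟩ : (H n).V × Fin (n + 1) := v
  change (((H n).graph □ SimpleGraph.pathGraph (n + 1)).neighborSet (w, i)).ncard ≤ K + 2
  rw [SimpleGraph.neighborSet_boxProd]
  refine (Set.ncard_union_le _ _).trans (add_le_add ?_ ?_)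
  · rw [Set.ncard_prod, Set.ncard_singleton, mul_one]
    exact hK n w
  · rw [Set.ncard_prod, Set.ncard_singleton, one_mul]
    have hinj : Set.InjOn (fun j : Fin (n + 1) => (j : ℕ))
        ((SimpleGraph.pathGraph (n + 1)).neighborSet i) := Fin.val_injective.injOn
    rw [← hinj.ncard_image]
    have hsub : (fun j : Fin (n + 1) => (j : ℕ)) ''
        (SimpleGraph.pathGraph (n + 1)).neighborSet i ⊆ {(i : ℕ) + 1, (i : ℕ) - 1} := by
      rintro _ ⟨j, hj, rfl⟩
      rw [SimpleGraph.mem_neighborSet, SimpleGraph.pathGraph_adj] at hj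
      simp only [Set.mem_insert_iff, Set.mem_singleton_iff]
      omega
    exact (Set.ncard_le_ncard hsub).trans ((Set.ncard_insert_le _ _).trans (by simp))

/-- The lower half of a long product with a path has a small boundary. -/
theorem cheeger_boxProd_pathGraph_le {W : Type} [Finite W] [Nonempty W] (G : SimpleGraph W)
    {k n : ℕ} (hk : 0 < k) (hkn : 2 * k ≤ n + 1) :
    cheeger (G □ SimpleGraph.pathGraph (n + 1)) ≤ (k : ℝ≥0∞)⁻¹ := by
  have hkn' : k < n + 1 := by omega
  -- The layers `0, …, k - 1`: the boundary lies in layer `k`, whence the ratio `1 / k`.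
  let A : Set (W × Fin (n + 1)) := Set.univ ×ˢ Set.Iio ⟨k, hkn'⟩
  have hA : A.ncard = Nat.card W * k := by
    rw [Set.ncard_prod, Set.ncard_univ]
    congr 1
    rw [Set.ncard_eq_toFinset_card']
    simp
  have hW : 0 < Nat.card W := Nat.card_pos
  have hbd : (vertexBoundary (G □ SimpleGraph.pathGraph (n + 1)) A).ncard ≤ Nat.card W := by
    have hsub : vertexBoundary (G □ SimpleGraph.pathGraph (n + 1)) A ⊆
        Set.univ ×ˢ {(⟨k, hkn'⟩ : Fin (n + 1))} := by
      rintro ⟨w, i⟩ hw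
      obtain ⟨hw, ⟨w', j⟩, ha, hadj⟩ := (mem_vertexBoundary_iff _ _ _).1 hw
      simp only [A, Set.mem_prod, Set.mem_univ, true_and, Set.mem_Iio, Fin.lt_def] at hw ha
      rw [SimpleGraph.boxProd_adj, SimpleGraph.pathGraph_adj] at hadj
      simp only [Set.mem_prod, Set.mem_univ, true_and, Set.mem_singleton_iff, Fin.ext_iff] at hadj ⊢
      omega
    refine (Set.ncard_le_ncard hsub).trans ?_
    rw [Set.ncard_prod, Set.ncard_univ, Set.ncard_singleton, mul_one]
  refine (iInf_le _ A).trans ((iInf₂_le ?_ ?_).trans ?_)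
  · rw [hA]
    positivity
  · rw [hA, Nat.card_prod, Nat.card_fin, mul_left_comm]
    exact Nat.mul_le_mul_left _ hkn
  · rw [ENNReal.div_le_iff (by rw [hA]; exact_mod_cast (by positivity)) (ENNReal.natCast_ne_top _),
      hA, Nat.cast_mul, mul_left_comm, ENNReal.inv_mul_cancel (by exact_mod_cast hk.ne')
      (ENNReal.natCast_ne_top _), mul_one]
    exact_mod_cast hbd

theorem not_isExpanders_prodPath (H : ℕ → FiniteGraph) :
    ¬ IsExpanders fun n => ((H n).withCounting.prodPath n).toFiniteGraph := by
  rintro ⟨-, -, h⟩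
  obtain ⟨k, hk⟩ := ENNReal.exists_inv_nat_lt h.ne'
  -- Using `k + 1` avoids checking that `k` is positive; the index `2 * k + 1` gives exactly `2 * (k
  -- + 1)` layers.
  have hle : (⨅ n, cheeger ((H n).withCounting.prodPath n).graph) ≤ ((k + 1 : ℕ) : ℝ≥0∞)⁻¹ := by
    have : Nonempty (H (2 * k + 1)).V := (H (2 * k + 1)).connected.nonempty
    exact (iInf_le _ (2 * k + 1)).trans
      (cheeger_boxProd_pathGraph_le (H (2 * k + 1)).graph k.succ_pos (by omega))
  have hmono : ((k + 1 : ℕ) : ℝ≥0∞)⁻¹ ≤ (k : ℝ≥0∞)⁻¹ :=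
    ENNReal.inv_le_inv.2 (by exact_mod_cast k.le_succ)
  exact absurd (hle.trans hmono) (not_le.2 hk)

end MeasuredExpander

open MeasuredExpander in
theorem mainTheorem9 :
    (∃ (H : ℕ → FiniteGraph) (G : ℕ → FiniteMeasuredGraph),
      IsExpanders H ∧ (∀ n, G n = (H n).withCounting.prodPath n) ∧
        IsGhostly G ∧ IsMeasuredExpanders G ∧
        UniformlyBoundedValency (fun n => (G n).toFiniteGraph) ∧
        ¬ IsExpanders (fun n => (G n).toFiniteGraph)) ∧
    (∀ (H : ℕ → FiniteGraph) (G : ℕ → FiniteMeasuredGraph),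
      IsExpanders H → (∀ n, G n = (H n).withCounting.prodPath n) →
        IsGhostly G ∧ IsMeasuredExpanders G ∧
        UniformlyBoundedValency (fun n => (G n).toFiniteGraph) ∧
        ¬ IsExpanders (fun n => (G n).toFiniteGraph)) := by
  have key : ∀ (H : ℕ → FiniteGraph) (G : ℕ → FiniteMeasuredGraph),
      IsExpanders H → (∀ n, G n = (H n).withCounting.prodPath n) →
        IsGhostly G ∧ IsMeasuredExpanders G ∧
        UniformlyBoundedValency (fun n => (G n).toFiniteGraph) ∧
        ¬ IsExpanders (fun n => (G n).toFiniteGraph) := by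
    intro H G hH hG
    obtain rfl : G = fun n => (H n).withCounting.prodPath n := funext hG
    exact ⟨isGhostly_prodPath hH.2.1, isMeasuredExpanders_prodPath hH,
      uniformlyBoundedValency_prodPath hH.1, not_isExpanders_prodPath H⟩
  obtain ⟨H, hH⟩ := exists_isExpanders
  exact ⟨⟨H, _, hH, fun _ => rfl, key H _ hH fun _ => rfl⟩, key⟩
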